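/- **Conventions.** A morphism of probability spaces $(\Omega,\mathcal F,\mu)\to(\Omega',\mathcal F',\mu')$ is a measurable, measure-preserving map; an isomorphism is a morphism with a two-sided inverse morphism. All identities between maps below are identities of maps. Let $(\mathbb S,\le)$ be a linearly ordered set. A *convolution system* $\mathscr S=\{\Omega_{s,t},\mathcal F_{s,t},\mu_{s,t},T_{r,s,t}\}_{\mathbb S}$ consists of probability spaces $(\Omega_{s,t},\mathcal F_{s,t},\mu_{s,t})$ for $s<t$ in $\mathbb S$, and morphisms of probability spaces $T_{r,s,t}:\Omega_{r,s}\times\Omega_{s,t}\to\Omega_{r,t}$ for $r<s<t$ such that $T_{r,t,u}(T_{r,s,t}\times\mathrm{id})=T_{r,s,u}(\mathrm{id}\times T_{s,t,u})$ for all $r<s<t<u$. It is a *continuous product of probability spaces (CPPS)* if every $T_{r,s,t}$ is an isomorphism. A *morphism* $\theta:\mathscr S\to\mathscr S'$ of convolution systems over $\mathbb S$ is a family of morphisms of probability spaces $\theta_{s,t}:\Omega_{s,t}\to\Omega'_{s,t}$ $(s<t)$ with $\theta_{r,t}T_{r,s,t}=T'_{r,s,t}(\theta_{r,s}\times\theta_{s,t})$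 for all $r<s<t$. It is an *isomorphism* if it has a two-sided inverse morphism. An isomorphism of CPPSs is an isomorphism of the underlying convolution systems. For $s<t$ let $\mathcal K_{s,t}$ be the set of finite partitions $I=\{s=\iota_0<\iota_1<\dots<\iota_{m+1}=t\}$ of $[s,t]$, directed by inclusion, and let $(\Omega_I,\mathcal F_I,\mu_I)$ be the product probability space $\prod_{k=0}^m(\Omega_{\iota_k,\iota_{k+1}},\mathcal F_{\iota_k,\iota_{k+1}},\mu_{\iota_k,\iota_{k+1}})$. For $I\subseteq J$ in $\mathcal K_{s,t}$ let $T_{I,J}:\Omega_J\to\Omega_I$ be the product over $k$ of the iterated multiplications $\Omega_{J\cap[\iota_k,\iota_{k+1}]}\to\Omega_{\iota_k,\iota_{k+1}}$ of $\mathscr S$. This is a projective system of probability spaces. Let $\Omega^\flat_{s,t}=\{(\omega_I)_I:\ T_{I,J}(\omega_J)=\omega_I \text{ for all } I\subseteq J\}$ be its projective limit in the category of sets, with coordinate projections $T^\flat_I:\Omega^\flat_{s,t}\to\Omega_I$. The system $\mathscr S$ is *convergent* if for all $s<t$: (a) $\Omega^\flat_{s,t}$ is nonempty and every $T^\flat_I$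 is surjective; and (b) the set function $\mu$ on the field $\bigcup_I (T^\flat_I)^{-1}(\mathcal F_I)$, well defined by $\mu((T^\flat_I)^{-1}(A))=\mu_I(A)$ for $A\in\mathcal F_I$, is $\sigma$-additive. In that case let $\mathcal F^\flat_{s,t}$ be the $\sigma$-field generated by this field and let $\mu^\flat_{s,t}$ be the unique $\sigma$-additive extension of $\mu$ to $\mathcal F^\flat_{s,t}$. For $r<s<t$ there is a unique map $T^\flat_{r,s,t}:\Omega^\flat_{r,s}\times\Omega^\flat_{s,t}\to\Omega^\flat_{r,t}$ such that $T^\flat_{A\cup B}T^\flat_{r,s,t}=T^\flat_A\times T^\flat_B$ for all $A\in\mathcal K_{r,s}$, $B\in\mathcal K_{s,t}$ (where $\Omega_{A\cup B}=\Omega_A\times\Omega_B$), and $\mathscr S^\flat=\{\Omega^\flat_{s,t},\mathcal F^\flat_{s,t},\mu^\flat_{s,t},T^\flat_{r,s,t}\}_{\mathbb S}$ is a CPPS, called the *projective CPPS associated with $\mathscr S$*. The coordinate projections $T^\flat_{\{s,t\}}:\Omega^\flat_{s,t}\to\Omega_{s,t}$ at the trivial partitions form a morphism of convolution systems $\tau_{\mathscr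 S}:\mathscr S^\flat\to\mathscr S$. **Corollary.** Let $\mathscr S_1$ and $\mathscr S_2$ be convergent convolution systems over $\mathbb S$, and let $\theta:\mathscr S_1\to\mathscr S_2$ be an isomorphism of convolution systems. Then there exists an isomorphism of CPPSs $\theta^\flat:\mathscr S_1^\flat\to\mathscr S_2^\flat$ such that $\theta\,\tau_{\mathscr S_1}=\tau_{\mathscr S_2}\,\theta^\flat$. -/

import Mathlib

open MeasureTheory Set Function
open scoped ENNReal

universe u v w u'

/-- An isomorphism in the category of probability spaces: a measure preserving map with a measure
preserving two-sided inverse. -/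
def IsProbIso {α : Type*} {β : Type*} [MeasurableSpace α] [MeasurableSpace β]
    (f : α → β) (μ : Measure α) (ν : Measure β) : Prop :=
  MeasurePreserving f μ ν ∧
    ∃ g : β → α, MeasurePreserving g ν μ ∧ LeftInverse g f ∧ RightInverse g f

/-- A projective system of probability spaces over a directed set. -/
structure ProjSystem (ι : Type u) [Preorder ι] [IsDirectedOrder ι] where
  Ω : ι → Type v
  [mΩ : ∀ i, MeasurableSpace (Ω i)]
  μ : ∀ i, Measure (Ω i)
  [prob : ∀ i, IsProbabilityMeasure (μ i)]
  T : ∀ {i j : ι}, i ≤ j → Ω j → Ω i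
  measurePreserving_T : ∀ {i j : ι} (h : i ≤ j), MeasurePreserving (T h) (μ j) (μ i)
  T_refl : ∀ (i : ι) (x : Ω i), T (le_refl i) x = x
  T_trans : ∀ {i j k : ι} (h : i ≤ j) (h' : j ≤ k) (x : Ω k), T h (T h' x) = T (h.trans h') x

namespace ProjSystem

attribute [instance] ProjSystem.mΩ ProjSystem.prob

variable {ι : Type u} [Preorder ι] [IsDirectedOrder ι] (P : ProjSystem.{u, v} ι)

/-- The projective limit in the category of sets: the set of threads. -/
def Thread : Type (max u v) :=
  {ω : ∀ i, P.Ω i // ∀ (i j : ι) (h : i ≤ j), P.T h (ω j) = ω i}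

/-- The coordinate projections. -/
def proj (i : ι) (ω : P.Thread) : P.Ω i := ω.1 i

theorem T_proj {i j : ι} (h : i ≤ j) (ω : P.Thread) : P.T h (P.proj j ω) = P.proj i ω :=
  ω.2 i j h

theorem thread_ext {ω ω' : P.Thread} (h : ∀ i, P.proj i ω = P.proj i ω') : ω = ω' :=
  Subtype.ext (funext h)

/-- The set of threads is nonempty and all coordinate projections are surjective. -/
def SimplyMaximal : Prop := Nonempty P.Thread ∧ ∀ i, Surjective (P.proj i)

/-- The join of the pulled back `σ`-fields. -/
instance : MeasurableSpace P.Thread := ⨆ i, (P.mΩ i).comap (P.proj i)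

/-- The field `⋃ i, (proj i)⁻¹ (𝓕 i)` of cylinder sets. -/
def cylinders : Set (Set P.Thread) :=
  {B | ∃ (i : ι) (A : Set (P.Ω i)), MeasurableSet A ∧ P.proj i ⁻¹' A = B}

/-- The set function with value `μ i A` on the cylinder set `(proj i)⁻¹ A`; see
`content_preimage` for the fact that this is independent of the representation. -/
noncomputable def content (B : Set P.Thread) : ℝ≥0∞ :=
  ⨅ (i : ι) (A : Set (P.Ω i)) (_ : MeasurableSet A) (_ : P.proj i ⁻¹' A = B), P.μ i A

/-- A projective system is convergent if it is simply maximal and the set function on the field of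
cylinder sets is `σ`-additive. -/
def Convergent : Prop :=
  P.SimplyMaximal ∧
    ∀ B : ℕ → Set P.Thread, (∀ n, B n ∈ P.cylinders) → Pairwise (Disjoint on B) →
      (⋃ n, B n) ∈ P.cylinders → P.content (⋃ n, B n) = ∑' n, P.content (B n)

theorem measurable_proj (i : ι) : Measurable (P.proj i) :=
  Measurable.of_comap_le (le_iSup (fun i => (P.mΩ i).comap (P.proj i)) i)

theorem measurable_thread {α : Type*} [MeasurableSpace α] {f : α → P.Thread}
    (hf : ∀ i, Measurable fun a => P.proj i (f a)) : Measurable f := by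
  rw [measurable_iff_comap_le]
  change MeasurableSpace.comap f (⨆ i, (P.mΩ i).comap (P.proj i)) ≤ _
  rw [MeasurableSpace.comap_iSup]
  refine iSup_le fun i => ?_
  rw [MeasurableSpace.comap_comp]
  exact (hf i).comap_le

theorem preimage_T {i j : ι} (h : i ≤ j) (A : Set (P.Ω i)) :
    P.proj j ⁻¹' (P.T h ⁻¹' A) = P.proj i ⁻¹' A := by
  ext ω; simp [P.T_proj h]

theorem measure_T {i j : ι} (h : i ≤ j) {A : Set (P.Ω i)} (hA : MeasurableSet A) :
    P.μ j (P.T h ⁻¹' A) = P.μ i A :=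
  (P.measurePreserving_T h).measure_preimage hA.nullMeasurableSet

/-- The content is well defined on cylinder sets. -/
theorem content_preimage (hP : P.SimplyMaximal) (i : ι) {A : Set (P.Ω i)} (hA : MeasurableSet A) :
    P.content (P.proj i ⁻¹' A) = P.μ i A := by
  refine le_antisymm (iInf₂_le_of_le i A (iInf₂_le_of_le hA rfl le_rfl)) ?_
  refine le_iInf₂ fun j A' => le_iInf₂ fun hA' h => le_of_eq ?_
  obtain ⟨k, hik, hjk⟩ := exists_ge_ge i j
  rw [← P.preimage_T hik, ← P.preimage_T hjk] at h
  rw [← P.measure_T hik hA, ← P.measure_T hjk hA', (hP.2 k).preimage_injective h]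

theorem exists_common {B C : Set P.Thread} (hB : B ∈ P.cylinders) (hC : C ∈ P.cylinders) :
    ∃ (k : ι) (A A' : Set (P.Ω k)), MeasurableSet A ∧ MeasurableSet A' ∧
      P.proj k ⁻¹' A = B ∧ P.proj k ⁻¹' A' = C := by
  obtain ⟨i, A, hA, rfl⟩ := hB
  obtain ⟨j, A', hA', rfl⟩ := hC
  obtain ⟨k, hik, hjk⟩ := exists_ge_ge i j
  exact ⟨k, _, _, (P.measurePreserving_T hik).measurable hA,
    (P.measurePreserving_T hjk).measurable hA', P.preimage_T hik _, P.preimage_T hjk _⟩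

theorem isSetRing_cylinders [Nonempty ι] : IsSetRing P.cylinders where
  empty_mem := ⟨Classical.arbitrary ι, ∅, MeasurableSet.empty, rfl⟩
  union_mem _ _ hs ht := by
    obtain ⟨k, A, A', hA, hA', rfl, rfl⟩ := P.exists_common hs ht
    exact ⟨k, A ∪ A', hA.union hA', rfl⟩
  sdiff_mem _ _ hs ht := by
    obtain ⟨k, A, A', hA, hA', rfl, rfl⟩ := P.exists_common hs ht
    exact ⟨k, A \ A', hA.diff hA', rfl⟩

theorem generateFrom_cylinders :
    (inferInstance : MeasurableSpace P.Thread) = MeasurableSpace.generateFrom P.cylinders := by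
  apply le_antisymm
  · refine iSup_le fun i => ?_
    rintro _ ⟨A, hA, rfl⟩
    exact MeasurableSpace.measurableSet_generateFrom ⟨i, A, hA, rfl⟩
  · refine MeasurableSpace.generateFrom_le ?_
    rintro _ ⟨i, A, hA, rfl⟩
    exact P.measurable_proj i hA

theorem exists_limitMeasure [Nonempty ι] (hP : P.Convergent) :
    ∃ m : Measure P.Thread, ∀ B ∈ P.cylinders, m B = P.content B := by
  have hR := P.isSetRing_cylinders
  have h0 : P.content ∅ = 0 := by
    have := P.content_preimage hP.1 (Classical.arbitrary ι) MeasurableSet.empty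
    simpa using this
  let m : AddContent ℝ≥0∞ P.cylinders := hR.addContent_of_union P.content h0 (by
    intro s t hs ht hd
    obtain ⟨k, A, A', hA, hA', rfl, rfl⟩ := P.exists_common hs ht
    rw [← preimage_union, P.content_preimage hP.1 k (hA.union hA'),
      P.content_preimage hP.1 k hA, P.content_preimage hP.1 k hA', measure_union _ hA']
    exact (disjoint_preimage_iff (hP.1.2 k)).1 hd)
  have hm : m.IsSigmaSubadditive :=
    isSigmaSubadditive_of_addContent_iUnion_eq_tsum hR fun f hf hU hd => hP.2 f hf hd hU
  exact ⟨m.measure hR.isSetSemiring (P.generateFrom_cylinders).le hm, fun B hB =>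
    m.measure_eq hR.isSetSemiring P.generateFrom_cylinders hm hB⟩

/-- The `σ`-additive extension of the content to the `σ`-field of the projective limit. It is
unique, see `limit_ext`. -/
noncomputable def limitMeasure [Nonempty ι] (hP : P.Convergent) : Measure P.Thread :=
  (P.exists_limitMeasure hP).choose

theorem measurePreserving_proj [Nonempty ι] (hP : P.Convergent) (i : ι) :
    MeasurePreserving (P.proj i) (P.limitMeasure hP) (P.μ i) := by
  refine ⟨P.measurable_proj i, Measure.ext fun A hA => ?_⟩
  rw [Measure.map_apply (P.measurable_proj i) hA]
  exact ((P.exists_limitMeasure hP).choose_spec _ ⟨i, A, hA, rfl⟩).trans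
    (P.content_preimage hP.1 i hA)

instance [Nonempty ι] (hP : P.Convergent) : IsProbabilityMeasure (P.limitMeasure hP) := by
  constructor
  have := (P.measurePreserving_proj hP (Classical.arbitrary ι)).measure_preimage
    MeasurableSet.univ.nullMeasurableSet
  simpa using this

theorem limit_ext [Nonempty ι] {m m' : Measure P.Thread} [IsProbabilityMeasure m]
    [IsProbabilityMeasure m'] (h : ∀ i, m.map (P.proj i) = m'.map (P.proj i)) : m = m' := by
  refine ext_of_generate_finite P.cylinders P.generateFrom_cylinders
    P.isSetRing_cylinders.isSetSemiring.isPiSystem ?_ (by simp)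
  rintro _ ⟨i, A, hA, rfl⟩
  rw [← Measure.map_apply (P.measurable_proj i) hA, h i,
    Measure.map_apply (P.measurable_proj i) hA]

end ProjSystem

/-- A convolution system of probability spaces over a linearly ordered set. -/
structure ConvolutionSystem (S : Type u) [LinearOrder S] where
  Ω : ∀ {s t : S}, s < t → Type v
  [mΩ : ∀ {s t : S} (h : s < t), MeasurableSpace (Ω h)]
  μ : ∀ {s t : S} (h : s < t), Measure (Ω h)
  [prob : ∀ {s t : S} (h : s < t), IsProbabilityMeasure (μ h)]
  T : ∀ {r s t : S} (h : r < s) (h' : s < t), Ω h × Ω h' → Ω (h.trans h')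
  measurePreserving_T : ∀ {r s t : S} (h : r < s) (h' : s < t),
    MeasurePreserving (T h h') ((μ h).prod (μ h')) (μ (h.trans h'))
  assoc : ∀ {r s t u : S} (h : r < s) (h' : s < t) (h'' : t < u) (x : Ω h) (y : Ω h') (z : Ω h''),
    T (h.trans h') h'' (T h h' (x, y), z) = T h (h'.trans h'') (x, T h' h'' (y, z))

/-- A continuous product of probability spaces: a convolution system whose multiplication consists
of isomorphisms of probability spaces. -/
structure CPPS (S : Type u) [LinearOrder S] extends ConvolutionSystem.{u, v} S where
  isProbIso_T : ∀ {r s t : S} (h : r < s) (h' : s < t),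
    IsProbIso (T h h') ((μ h).prod (μ h')) (μ (h.trans h'))

/-- The finite partitions `{s = ι₀ < ι₁ < ⋯ < ιₘ < ιₘ₊₁ = t}` of the interval `[s, t]`:
`single` is the trivial partition `{s, t}`, and `snoc I h` is `I ∪ {t}` for a partition `I` of
`[s, j]` with `j < t`. -/
inductive IntervalPartition {S : Type u} [LinearOrder S] (s : S) : S → Type u
  | single {t : S} (h : s < t) : IntervalPartition s t
  | snoc {j t : S} (I : IntervalPartition s j) (h : j < t) : IntervalPartition s t

namespace IntervalPartition

variable {S : Type u} [LinearOrder S]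

theorem lt {s t : S} : IntervalPartition s t → s < t
  | single h => h
  | snoc I h => I.lt.trans h

/-- The finite subset of `S` underlying a partition. -/
def points {s t : S} : IntervalPartition s t → Finset S
  | single _ => {s, t}
  | snoc I _ => insert t I.points

/-- Partitions are ordered by inclusion: `I ≤ J` if `J` is a refinement of `I`. -/
instance {s t : S} : Preorder (IntervalPartition s t) := Preorder.lift points

theorem le_iff {s t : S} {I J : IntervalPartition s t} : I ≤ J ↔ I.points ⊆ J.points := Iff.rfl

/-- The union of a partition of `[r, s]` and a partition of `[s, t]`. -/
def append {r s : S} (I : IntervalPartition r s) : {t : S} → IntervalPartition s t →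
    IntervalPartition r t
  | _, single h => snoc I h
  | _, snoc J h => snoc (I.append J) h

theorem left_mem {s t : S} (I : IntervalPartition s t) : s ∈ I.points := by
  induction I with
  | single h => simp [points]
  | snoc I h ih => simp [points, ih]

theorem right_mem {s t : S} (I : IntervalPartition s t) : t ∈ I.points := by
  cases I <;> simp [points]

theorem le_of_mem {s t : S} (I : IntervalPartition s t) {x : S} (hx : x ∈ I.points) :
    s ≤ x ∧ x ≤ t := by
  induction I with
  | single h =>
    simp only [points, Finset.mem_insert, Finset.mem_singleton] at hx
    rcases hx with rfl | rfl
    · exact ⟨le_rfl, h.le⟩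
    · exact ⟨h.le, le_rfl⟩
  | snoc I h ih =>
    simp only [points, Finset.mem_insert] at hx
    rcases hx with rfl | hx
    · exact ⟨(I.lt.trans h).le, le_rfl⟩
    · exact ⟨(ih hx).1, (ih hx).2.trans h.le⟩

theorem points_append {r s t : S} (I : IntervalPartition r s) (J : IntervalPartition s t) :
    (I.append J).points = I.points ∪ J.points := by
  induction J with
  | single h =>
    ext x
    have := I.right_mem
    simp only [append, points, Finset.mem_insert, Finset.mem_union, Finset.mem_singleton]
    grind
  | snoc J h ih => simp [append, points, ih]

/-- Every intermediate point of a partition splits it into two partitions. -/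
theorem exists_append {r t s : S} (I : IntervalPartition r t) (hs : s ∈ I.points) (h1 : r < s)
    (h2 : s < t) :
    ∃ (A : IntervalPartition r s) (B : IntervalPartition s t), A.append B = I := by
  induction I with
  | single h =>
    simp only [points, Finset.mem_insert, Finset.mem_singleton] at hs
    rcases hs with rfl | rfl
    · exact absurd h1 (lt_irrefl _)
    · exact absurd h2 (lt_irrefl _)
  | @snoc j t I h ih =>
    simp only [points, Finset.mem_insert] at hs
    rcases hs with rfl | hs
    · exact absurd h2 (lt_irrefl _)
    · rcases (I.le_of_mem hs).2.eq_or_lt with rfl | hlt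
      · exact ⟨I, single h, rfl⟩
      · obtain ⟨A, B, rfl⟩ := ih hs hlt
        exact ⟨A, snoc B h, rfl⟩

theorem points_left {r s t : S} (A : IntervalPartition r s) (B : IntervalPartition s t) :
    A.points = {x ∈ (A.append B).points | x ≤ s} := by
  ext x
  have h1 := fun h => (A.le_of_mem (x := x) h).2
  have h2 := fun h => (B.le_of_mem (x := x) h).1
  have := A.right_mem
  simp only [points_append, Finset.mem_filter, Finset.mem_union]
  grind

theorem points_right {r s t : S} (A : IntervalPartition r s) (B : IntervalPartition s t) :
    B.points = {x ∈ (A.append B).points | s ≤ x} := by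
  ext x
  have h1 := fun h => (A.le_of_mem (x := x) h).2
  have h2 := fun h => (B.le_of_mem (x := x) h).1
  have := B.left_mem
  simp only [points_append, Finset.mem_filter, Finset.mem_union]
  grind

theorem append_le_append {r s t : S} {A A' : IntervalPartition r s} {B B' : IntervalPartition s t} :
    A.append B ≤ A'.append B' ↔ A ≤ A' ∧ B ≤ B' := by
  constructor
  · intro h
    rw [le_iff, le_iff, points_left A B, points_left A' B', points_right A B, points_right A' B']
    exact ⟨Finset.filter_subset_filter _ h, Finset.filter_subset_filter _ h⟩
  · rintro ⟨h, h'⟩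
    rw [le_iff, points_append, points_append]
    exact Finset.union_subset_union h h'

theorem points_erase {s j t : S} (I : IntervalPartition s j) (h : j < t) :
    I.points = (snoc I h).points.erase t := by
  rw [points, Finset.erase_insert]
  exact fun hm => absurd h (I.le_of_mem hm).2.not_gt

/-- A partition is determined by its set of points. -/
theorem points_injective {s t : S} : Injective (points : IntervalPartition s t → Finset S) := by
  have key : ∀ {t t' : S} (I : IntervalPartition s t) (h : t < t'), (snoc I h).points ≠ {s, t'} := by
    intro t t' I h he
    have : t ∈ ({s, t'} : Finset S) := he ▸ by simp [points, I.right_mem]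
    simp only [Finset.mem_insert, Finset.mem_singleton] at this
    rcases this with h' | h'
    · exact I.lt.ne' h'
    · exact h.ne h'
  intro I
  induction I with
  | single h =>
    intro J hJ
    cases J with
    | single => rfl
    | snoc J h' => exact absurd hJ.symm (key J h')
  | @snoc j t I h ih =>
    intro J hJ
    cases J with
    | single => exact absurd hJ (key I h)
    | @snoc k _ J h' =>
      have hp : I.points = J.points := by rw [points_erase I h, hJ, ← points_erase J h']
      have hjk : j = k := le_antisymm (J.le_of_mem (hp ▸ I.right_mem)).2
        (I.le_of_mem (hp ▸ J.right_mem)).2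
      subst hjk
      rw [ih hp]

instance {s t : S} : PartialOrder (IntervalPartition s t) where
  le_antisymm _ _ h h' := points_injective (Finset.Subset.antisymm h h')

theorem append_injective {r s t : S} {A A' : IntervalPartition r s} {B B' : IntervalPartition s t}
    (h : A.append B = A'.append B') : A = A' ∧ B = B' :=
  ⟨points_injective (by rw [points_left A B, h, ← points_left]),
    points_injective (by rw [points_right A B, h, ← points_right])⟩

theorem exists_mem_ge {s t : S} (I : IntervalPartition s t) {x : S} (h1 : s ≤ x) (h2 : x ≤ t) :
    ∃ J, I ≤ J ∧ x ∈ J.points := by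
  rcases h1.eq_or_lt with rfl | h1
  · exact ⟨I, le_rfl, I.left_mem⟩
  induction I with
  | @single t h =>
    rcases h2.eq_or_lt with rfl | h2
    · exact ⟨single h, le_rfl, by simp [points]⟩
    · refine ⟨snoc (single h1) h2, ?_, by simp [points]⟩
      rw [le_iff]; intro y; simp only [points, Finset.mem_insert, Finset.mem_singleton]; tauto
  | @snoc j t I h ih =>
    rcases h2.eq_or_lt with rfl | h2
    · exact ⟨snoc I h, le_rfl, by simp [points]⟩
    rcases le_or_gt x j with hj | hj
    · obtain ⟨J, hJ, hx⟩ := ih hj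
      exact ⟨snoc J h, Finset.insert_subset_insert _ hJ, by simp [points, hx]⟩
    · refine ⟨snoc (snoc I hj) h2, ?_, by simp [points]⟩
      rw [le_iff]; intro y; simp only [points, Finset.mem_insert]; tauto

instance {s t : S} : IsDirectedOrder (IntervalPartition s t) where
  directed I J := by
    have key : ∀ F : Finset S, F ⊆ I.points → ∃ K, J ≤ K ∧ F ⊆ K.points := by
      intro F
      induction F using Finset.induction_on with
      | empty => exact fun _ => ⟨J, le_rfl, by simp⟩
      | insert x F _ ih =>
        intro hF
        rw [Finset.insert_subset_iff] at hF
        obtain ⟨K, hK, hFK⟩ := ih hF.2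
        obtain ⟨L, hL, hx⟩ := K.exists_mem_ge (I.le_of_mem hF.1).1 (I.le_of_mem hF.1).2
        exact ⟨L, hK.trans hL, Finset.insert_subset hx (hFK.trans hL)⟩
    obtain ⟨K, hK, hI⟩ := key _ subset_rfl
    exact ⟨K, hI, hK⟩

theorem exists_le_append {r s t : S} (I : IntervalPartition r t) (h1 : r < s) (h2 : s < t) :
    ∃ (A : IntervalPartition r s) (B : IntervalPartition s t), I ≤ A.append B := by
  obtain ⟨J, hJ, hs⟩ := I.exists_mem_ge h1.le h2.le
  obtain ⟨A, B, rfl⟩ := J.exists_append hs h1 h2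
  exact ⟨A, B, hJ⟩

theorem single_le {s t : S} (h : s < t) (J : IntervalPartition s t) : single h ≤ J := by
  rw [le_iff]
  intro x
  simp only [points, Finset.mem_insert, Finset.mem_singleton]
  rintro (rfl | rfl)
  exacts [J.left_mem, J.right_mem]

/-- The decomposition `J = I₀ ∪ I₁ ∪ ⋯ ∪ Iₘ` of a refinement `J` of
`I = {ι₀ < ι₁ < ⋯ < ιₘ₊₁}`, where `Iₖ` is a partition of `[ιₖ, ιₖ₊₁]`. -/
inductive Refinement {s : S} : {t : S} → IntervalPartition s t → IntervalPartition s t → Type u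
  | single {t : S} (h : s < t) (J : IntervalPartition s t) : Refinement (.single h) J
  | snoc {j t : S} {I J : IntervalPartition s j} (R : Refinement I J) (h : j < t)
      (K : IntervalPartition j t) : Refinement (.snoc I h) (J.append K)

theorem nonempty_refinement {s t : S} {I J : IntervalPartition s t} (h : I ≤ J) :
    Nonempty (Refinement I J) := by
  induction I with
  | single hs => exact ⟨.single hs J⟩
  | @snoc j t I hj ih =>
    obtain ⟨A, B, rfl⟩ := J.exists_append (h (by simp [points, I.right_mem])) I.lt hj
    have : I.append (IntervalPartition.single hj) ≤ A.append B := h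
    obtain ⟨R⟩ := ih (append_le_append.1 this).1
    exact ⟨.snoc R hj B⟩

theorem Refinement.exists_snoc {s j t : S} {I : IntervalPartition s j} {h : j < t}
    {L : IntervalPartition s t} (R : Refinement (.snoc I h) L) :
    ∃ (J : IntervalPartition s j) (K : IntervalPartition j t) (R' : Refinement I J)
      (e : J.append K = L), e ▸ Refinement.snoc R' h K = R := by
  cases R with
  | snoc R h K => exact ⟨_, K, R, rfl, rfl⟩

theorem append_assoc {r s t u : S} (I : IntervalPartition r s) (J : IntervalPartition s t)
    (K : IntervalPartition t u) : I.append (J.append K) = (I.append J).append K := by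
  induction K with
  | single h => rfl
  | snoc K h ih => simp only [append, ih]

end IntervalPartition

namespace ConvolutionSystem

open IntervalPartition

attribute [instance] ConvolutionSystem.mΩ ConvolutionSystem.prob

variable {S : Type u} [LinearOrder S] (X : ConvolutionSystem.{u, v} S)

/-- The product `Ω_{ι₀,ι₁} × ⋯ × Ω_{ιₘ,ιₘ₊₁}` over a partition. -/
def space {s : S} : {t : S} → IntervalPartition s t → Type v
  | _, .single h => X.Ω h
  | _, .snoc I h => space I × X.Ω h

/-- The product `σ`-field over a partition. -/
instance instMeasurableSpaceSpace {s : S} : {t : S} → (I : IntervalPartition s t) →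
    MeasurableSpace (X.space I)
  | _, .single h => X.mΩ h
  | _, .snoc I h => @Prod.instMeasurableSpace _ _ (instMeasurableSpaceSpace I) (X.mΩ h)

/-- The product measure over a partition. -/
noncomputable def measure {s : S} : {t : S} → (I : IntervalPartition s t) → Measure (X.space I)
  | _, .single h => X.μ h
  | _, .snoc I h => (measure I).prod (X.μ h)

instance {s t : S} (I : IntervalPartition s t) : IsProbabilityMeasure (X.measure I) := by
  induction I with
  | single h => exact X.prob h
  | snoc I h ih =>
    exact (inferInstance : IsProbabilityMeasure ((X.measure I).prod (X.μ h)))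

/-- The identification of the product over `I ∪ J` with the product of the products over `I` and
over `J`. -/
def split {r s : S} (I : IntervalPartition r s) : {t : S} → (J : IntervalPartition s t) →
    X.space (I.append J) ≃ᵐ X.space I × X.space J
  | _, .single h => MeasurableEquiv.refl (X.space I × X.Ω h)
  | _, .snoc J h => ((split I J).prodCongr (MeasurableEquiv.refl (X.Ω h))).trans
      MeasurableEquiv.prodAssoc

theorem measurePreserving_split {r s t : S} (I : IntervalPartition r s)
    (J : IntervalPartition s t) :
    MeasurePreserving (X.split I J) (X.measure (I.append J))
      ((X.measure I).prod (X.measure J)) := by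
  induction J with
  | single h => exact MeasurePreserving.id ((X.measure I).prod (X.μ h))
  | snoc J h ih =>
    exact (measurePreserving_prodAssoc (X.measure I) (X.measure J) (X.μ h)).comp
      (ih.prod (MeasurePreserving.id (X.μ h)))

/-- The iterated multiplication `Ω_J → Ω_{s,t}`. -/
def comp {s : S} : {t : S} → (J : IntervalPartition s t) → X.space J → X.Ω J.lt
  | _, .single _ => id
  | _, .snoc J h => fun x => X.T J.lt h (comp J x.1, x.2)

theorem measurePreserving_comp {s t : S} (J : IntervalPartition s t) :
    MeasurePreserving (X.comp J) (X.measure J) (X.μ J.lt) := by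
  induction J with
  | single h => exact MeasurePreserving.id (X.μ h)
  | snoc J h ih =>
    exact (X.measurePreserving_T J.lt h).comp (ih.prod (MeasurePreserving.id (X.μ h)))

theorem comp_append {r s t : S} (I : IntervalPartition r s) (J : IntervalPartition s t)
    (z : X.space (I.append J)) :
    X.comp (I.append J) z =
      X.T I.lt J.lt (X.comp I (X.split I J z).1, X.comp J (X.split I J z).2) := by
  induction J with
  | single h => rfl
  | snoc J h ih =>
    change X.T _ h (X.comp (I.append J) z.1, z.2) = _
    rw [ih]
    exact X.assoc I.lt J.lt h _ _ _

/-- The map `T_{I,J} : Ω_J → Ω_I` attached to the decomposition `J = I₀ ∪ ⋯ ∪ Iₘ`, which is the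
product of the iterated multiplications `Ω_{Iₖ} → Ω_{ιₖ,ιₖ₊₁}`. -/
def restrictAux {s : S} : {t : S} → {I J : IntervalPartition s t} → Refinement I J →
    X.space J → X.space I
  | _, _, _, .single _ J => X.comp J
  | _, _, _, .snoc (J := J) R _ K => fun x =>
      (restrictAux R (X.split J K x).1, X.comp K (X.split J K x).2)

/-- The map `T_{I,J} : Ω_J → Ω_I` for a refinement `J` of `I`. -/
noncomputable def restrict {s t : S} {I J : IntervalPartition s t} (h : I ≤ J) :
    X.space J → X.space I :=
  X.restrictAux (nonempty_refinement h).some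

theorem restrictAux_eq {s t : S} {I J : IntervalPartition s t} (R R' : Refinement I J) :
    X.restrictAux R = X.restrictAux R' := by
  induction R with
  | single h J => cases R'; rfl
  | @snoc j t I J R h K ih =>
    obtain ⟨J', K', R'', e, rfl⟩ := R'.exists_snoc
    obtain ⟨rfl, rfl⟩ := append_injective e
    funext x
    change (X.restrictAux R _, _) = (X.restrictAux R'' _, _)
    rw [ih R'']

theorem restrict_eq {s t : S} {I J : IntervalPartition s t} (h : I ≤ J) (R : Refinement I J) :
    X.restrict h = X.restrictAux R := X.restrictAux_eq _ _

theorem measurePreserving_restrict {s t : S} {I J : IntervalPartition s t} (h : I ≤ J) :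
    MeasurePreserving (X.restrict h) (X.measure J) (X.measure I) := by
  obtain ⟨R⟩ := nonempty_refinement h
  rw [X.restrict_eq h R]
  clear h
  induction R with
  | single h J => exact X.measurePreserving_comp J
  | @snoc j t I J R h K ih =>
    exact (ih.prod (X.measurePreserving_comp K)).comp (X.measurePreserving_split J K)

theorem restrict_single {s t : S} (h : s < t) (J : IntervalPartition s t) :
    X.restrict (single_le h J) = X.comp J :=
  X.restrict_eq _ (.single h J)

theorem restrict_snoc {s j t : S} {I J : IntervalPartition s j} (h : j < t)
    (K : IntervalPartition j t) (hIJ : I ≤ J) (hle : I.snoc h ≤ J.append K)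
    (x : X.space (J.append K)) :
    X.restrict hle x = (X.restrict hIJ (X.split J K x).1, X.comp K (X.split J K x).2) := by
  obtain ⟨R⟩ := nonempty_refinement hIJ
  rw [X.restrict_eq hIJ R, X.restrict_eq hle (.snoc R h K)]
  rfl

/-- Transport along an equality of partitions. -/
def castSpace {s t : S} {I J : IntervalPartition s t} (e : I = J) (x : X.space I) : X.space J :=
  e ▸ x

theorem castSpace_snoc {s j t : S} {I J : IntervalPartition s j} (e : I = J) (h : j < t)
    (e' : I.snoc h = J.snoc h) (x : X.space I × X.Ω h) :
    X.castSpace e' x = (X.castSpace e x.1, x.2) := by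
  subst e; rfl

theorem restrict_castSpace {s t : S} {I J J' : IntervalPartition s t} (h : I ≤ J) (e : J = J')
    (h' : I ≤ J') (x : X.space J) : X.restrict h' (X.castSpace e x) = X.restrict h x := by
  subst e; rfl

theorem split_assoc {r s t u : S} (I : IntervalPartition r s) (J : IntervalPartition s t)
    (K : IntervalPartition t u) (x : X.space (I.append (J.append K))) :
    (X.split I J (X.split (I.append J) K (X.castSpace (append_assoc I J K) x)).1,
      (X.split (I.append J) K (X.castSpace (append_assoc I J K) x)).2) =
    (((X.split I (J.append K) x).1, (X.split J K (X.split I (J.append K) x).2).1),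
      (X.split J K (X.split I (J.append K) x).2).2) := by
  induction K with
  | single h => rfl
  | snoc K h ih =>
    have := ih x.1
    rw [Prod.ext_iff] at this
    have e := X.castSpace_snoc (append_assoc I J K) h (append_assoc I J (K.snoc h)) x
    refine (congrArg (fun z => (X.split I J (X.split (I.append J) (K.snoc h) z).1,
      (X.split (I.append J) (K.snoc h) z).2)) e).trans ?_
    exact Prod.ext this.1 (Prod.ext this.2 rfl)

theorem restrict_append {r s t : S} {A A' : IntervalPartition r s} {B B' : IntervalPartition s t}
    (hA : A ≤ A') (hB : B ≤ B') (h : A.append B ≤ A'.append B') (x : X.space (A'.append B')) :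
    X.split A B (X.restrict h x) =
      (X.restrict hA (X.split A' B' x).1, X.restrict hB (X.split A' B' x).2) := by
  induction B with
  | single hs =>
    have := X.restrict_snoc hs B' hA h x
    rw [X.restrict_single hs B']
    exact this
  | @snoc j t B hj ih =>
    obtain ⟨C, D, rfl⟩ := B'.exists_append (hB (by simp [points, B.right_mem])) B.lt hj
    have hB' : B.append (single hj) ≤ C.append D := hB
    have hBC : B ≤ C := (append_le_append.1 hB').1
    have hAC : A.append B ≤ A'.append C := append_le_append.2 ⟨hA, hBC⟩
    have h' : (A.append B).snoc hj ≤ (A'.append C).append D := by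
      rw [← append_assoc]; exact h
    have e1 := X.restrict_castSpace h (append_assoc A' C D) h' x
    have e2 := X.restrict_snoc hj D hAC h' (X.castSpace (append_assoc A' C D) x)
    have e3 := ih hBC hAC (X.split (A'.append C) D (X.castSpace (append_assoc A' C D) x)).1
    have e4 := Prod.ext_iff.1 (X.split_assoc A' C D x)
    have e5 := X.restrict_snoc hj D hBC hB (X.split A' (C.append D) x).2
    have e6 := e1.symm.trans e2
    have e7 := Prod.ext_iff.1 e4.1
    simp only at e4 e7
    rw [e4.2] at e6
    rw [e7.1, e7.2] at e3
    rw [e5]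
    refine (congrArg (X.split A (B.snoc hj)) e6).trans ?_
    have e8 := congrArg Prod.fst e3
    have e9 := congrArg Prod.snd e3
    exact Prod.ext e8 (Prod.ext e9 rfl)

theorem comp_restrict {s t : S} {I J : IntervalPartition s t} (h : I ≤ J) (x : X.space J) :
    X.comp I (X.restrict h x) = X.comp J x := by
  induction I with
  | single hs => rw [X.restrict_single hs J]; rfl
  | @snoc j t I hj ih =>
    obtain ⟨A, B, rfl⟩ := J.exists_append (h (by simp [points, I.right_mem])) I.lt hj
    have h0 : I.append (single hj) ≤ A.append B := h
    have hI := (append_le_append.1 h0).1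
    rw [X.restrict_snoc hj B hI h, X.comp_append, ← ih hI]
    rfl

theorem restrict_restrict {s t : S} {I J K : IntervalPartition s t} (h : I ≤ J) (h' : J ≤ K)
    (x : X.space K) : X.restrict h (X.restrict h' x) = X.restrict (h.trans h') x := by
  induction I with
  | single hs => rw [X.restrict_single hs J, X.restrict_single hs K, X.comp_restrict]
  | @snoc j t I hj ih =>
    obtain ⟨A, B, rfl⟩ := J.exists_append (h (by simp [points, I.right_mem])) I.lt hj
    obtain ⟨C, D, rfl⟩ := K.exists_append (h' (h (by simp [points, I.right_mem]))) I.lt hj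
    have h0 : I.append (single hj) ≤ A.append B := h
    have hI := (append_le_append.1 h0).1
    obtain ⟨h1, h2⟩ := append_le_append.1 h'
    rw [X.restrict_snoc hj B hI h, X.restrict_snoc hj D (hI.trans h1) (h.trans h'),
      X.restrict_append h1 h2 h', ih hI h1, X.comp_restrict]

theorem restrict_refl {s t : S} (I : IntervalPartition s t) (x : X.space I) :
    X.restrict le_rfl x = x := by
  induction I with
  | single hs => exact congrFun (X.restrict_single hs (single hs)) x
  | snoc I hj ih =>
    have := X.restrict_snoc hj (single hj) (le_refl I) (le_refl (I.snoc hj)) x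
    exact this.trans (Prod.ext (ih x.1) rfl)

/-- The projective system of probability spaces attached to the partitions of `[s, t]`. -/
@[reducible]
noncomputable def system (s t : S) : ProjSystem.{u, v} (IntervalPartition s t) where
  Ω := X.space
  μ := X.measure
  T := X.restrict
  measurePreserving_T := X.measurePreserving_restrict
  T_refl := X.restrict_refl
  T_trans := X.restrict_restrict

/-- A convolution system is convergent if for all `s < t` the projective system over the partitions
of `[s, t]` is convergent. -/
def Convergent : Prop := ∀ s t : S, s < t → (X.system s t).Convergent

end ConvolutionSystem

namespace ConvolutionSystem

open IntervalPartition

variable {S : Type u} [LinearOrder S] (X : ConvolutionSystem.{u, v} S)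

/-- The underlying set of the projective limit over the partitions of `[s, t]`. -/
abbrev Flat (s t : S) : Type (max u v) := (X.system s t).Thread

theorem flat_ext {r s t : S} (h : r < s) (h' : s < t) {z z' : X.Flat r t}
    (H : ∀ (A : IntervalPartition r s) (B : IntervalPartition s t),
      (X.system r t).proj (A.append B) z = (X.system r t).proj (A.append B) z') : z = z' := by
  refine (X.system r t).thread_ext fun I => ?_
  obtain ⟨A, B, hI⟩ := I.exists_le_append h h'
  rw [← (X.system r t).T_proj hI, H, (X.system r t).T_proj hI]

/-- The point of `Ω_I × Ω_J = Ω_{I ∪ J}` with given components. -/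
noncomputable def glue {r s t : S} (A : IntervalPartition r s) (B : IntervalPartition s t)
    (p : X.Flat r s × X.Flat s t) : X.space (A.append B) :=
  (X.split A B).symm ((X.system r s).proj A p.1, (X.system s t).proj B p.2)

theorem restrict_glue {r s t : S} {A A' : IntervalPartition r s} {B B' : IntervalPartition s t}
    (h : A.append B ≤ A'.append B') (p : X.Flat r s × X.Flat s t) :
    X.restrict h (X.glue A' B' p) = X.glue A B p := by
  obtain ⟨hA, hB⟩ := append_le_append.1 h
  apply (X.split A B).injective
  rw [X.restrict_append hA hB, glue, glue, MeasurableEquiv.apply_symm_apply,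
    MeasurableEquiv.apply_symm_apply]
  exact Prod.ext ((X.system r s).T_proj hA p.1) ((X.system s t).T_proj hB p.2)

theorem restrict_glue_eq {r s t : S} {I : IntervalPartition r t}
    {A A' : IntervalPartition r s} {B B' : IntervalPartition s t}
    (h : I ≤ A.append B) (h' : I ≤ A'.append B') (p : X.Flat r s × X.Flat s t) :
    X.restrict h (X.glue A B p) = X.restrict h' (X.glue A' B' p) := by
  obtain ⟨C, hA, hA'⟩ := exists_ge_ge A A'
  obtain ⟨D, hB, hB'⟩ := exists_ge_ge B B'
  have h1 : A.append B ≤ C.append D := append_le_append.2 ⟨hA, hB⟩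
  have h2 : A'.append B' ≤ C.append D := append_le_append.2 ⟨hA', hB'⟩
  rw [← X.restrict_glue h1, ← X.restrict_glue h2, X.restrict_restrict, X.restrict_restrict]

/-- The multiplication on projective limits: the map whose coordinate at a partition `A ∪ B` of
`[r, t]` containing `s` is the pair of the coordinates at `A` and `B`; see `proj_flatMul`, and
`flat_ext` for the fact that this determines the map. -/
noncomputable def flatMul {r s t : S} (h : r < s) (h' : s < t) (p : X.Flat r s × X.Flat s t) :
    X.Flat r t :=
  ⟨fun I => X.restrict (I.exists_le_append h h').choose_spec.choose_spec (X.glue _ _ p), by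
    intro I J hIJ
    change X.restrict hIJ (X.restrict _ _) = _
    rw [X.restrict_restrict]
    exact X.restrict_glue_eq _ _ p⟩

theorem proj_flatMul_eq {r s t : S} (h : r < s) (h' : s < t) {I : IntervalPartition r t}
    {A : IntervalPartition r s} {B : IntervalPartition s t} (hI : I ≤ A.append B)
    (p : X.Flat r s × X.Flat s t) :
    (X.system r t).proj I (X.flatMul h h' p) = X.restrict hI (X.glue A B p) :=
  X.restrict_glue_eq (I.exists_le_append h h').choose_spec.choose_spec hI p

theorem proj_flatMul {r s t : S} (h : r < s) (h' : s < t)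
    (A : IntervalPartition r s) (B : IntervalPartition s t) (p : X.Flat r s × X.Flat s t) :
    X.split A B ((X.system r t).proj (A.append B) (X.flatMul h h' p)) =
      ((X.system r s).proj A p.1, (X.system s t).proj B p.2) := by
  rw [X.proj_flatMul_eq h h' (le_refl _), X.restrict_refl, glue, MeasurableEquiv.apply_symm_apply]

theorem flatMul_assoc {r s t q : S} (h : r < s) (h' : s < t) (h'' : t < q) (x : X.Flat r s)
    (y : X.Flat s t) (z : X.Flat t q) :
    X.flatMul (h.trans h') h'' (X.flatMul h h' (x, y), z) =
      X.flatMul h (h'.trans h'') (x, X.flatMul h' h'' (y, z)) := by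
  refine X.flat_ext (h.trans h') h'' fun I C => ?_
  obtain ⟨A, B, hI⟩ := I.exists_le_append h h'
  have hle : I.append C ≤ (A.append B).append C := append_le_append.2 ⟨hI, le_rfl⟩
  rw [← (X.system r q).T_proj hle, ← (X.system r q).T_proj hle]
  congr 1
  apply (X.split _ _).injective
  rw [X.proj_flatMul]
  have e := X.proj_flatMul h (h'.trans h'') A (B.append C) (x, X.flatMul h' h'' (y, z))
  have key : ∀ w : X.Flat r q, X.castSpace (append_assoc A B C)
      ((X.system r q).proj (A.append (B.append C)) w) =
      (X.system r q).proj ((A.append B).append C) w := by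
    intro w
    generalize (A.append B).append C = L, append_assoc A B C = e
    subst e
    rfl
  have e2 := Prod.ext_iff.1 (X.split_assoc A B C ((X.system r q).proj (A.append (B.append C))
    (X.flatMul h (h'.trans h'') (x, X.flatMul h' h'' (y, z)))))
  rw [key, e, X.proj_flatMul] at e2
  refine Prod.ext ?_ e2.2.symm
  apply (X.split A B).injective
  refine Eq.trans ?_ e2.1.symm
  exact X.proj_flatMul h h' A B (x, y)

variable {X} (hX : X.Convergent)

/-- The measure of the projective limit over the partitions of `[s, t]`. -/
noncomputable def Convergent.flatMeasure {s t : S} (h : s < t) : Measure (X.Flat s t) :=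
  haveI : Nonempty (IntervalPartition s t) := ⟨.single h⟩
  (X.system s t).limitMeasure (hX s t h)

instance {s t : S} (h : s < t) : IsProbabilityMeasure (hX.flatMeasure h) :=
  haveI : Nonempty (IntervalPartition s t) := ⟨.single h⟩
  (inferInstance : IsProbabilityMeasure ((X.system s t).limitMeasure (hX s t h)))

theorem Convergent.measurePreserving_proj {s t : S} (h : s < t) (I : IntervalPartition s t) :
    MeasurePreserving ((X.system s t).proj I) (hX.flatMeasure h) (X.measure I) :=
  haveI : Nonempty (IntervalPartition s t) := ⟨.single h⟩
  (X.system s t).measurePreserving_proj (hX s t h) I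

theorem Convergent.measurePreserving_of_proj {α : Type*} [MeasurableSpace α] {m : Measure α}
    [IsProbabilityMeasure m] {s t : S} (h : s < t) {f : α → X.Flat s t}
    (hf : ∀ I, MeasurePreserving (fun a => (X.system s t).proj I (f a)) m (X.measure I)) :
    MeasurePreserving f m (hX.flatMeasure h) := by
  have : Nonempty (IntervalPartition s t) := ⟨.single h⟩
  have hm : Measurable f := (X.system s t).measurable_thread fun i => (hf i).measurable
  have := Measure.isProbabilityMeasure_map (μ := m) hm.aemeasurable
  refine ⟨hm, (X.system s t).limit_ext fun I => ?_⟩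
  rw [Measure.map_map ((X.system s t).measurable_proj I) hm]
  exact (hf I).map_eq.trans (hX.measurePreserving_proj h I).map_eq.symm

theorem Convergent.measurePreserving_glue {r s t : S} (h : r < s) (h' : s < t)
    (A : IntervalPartition r s) (B : IntervalPartition s t) :
    MeasurePreserving (X.glue A B) ((hX.flatMeasure h).prod (hX.flatMeasure h'))
      (X.measure (A.append B)) :=
  ((X.measurePreserving_split A B).symm _).comp
    ((hX.measurePreserving_proj h A).prod (hX.measurePreserving_proj h' B))

theorem Convergent.measurePreserving_flatMul {r s t : S} (h : r < s) (h' : s < t) :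
    MeasurePreserving (X.flatMul h h') ((hX.flatMeasure h).prod (hX.flatMeasure h'))
      (hX.flatMeasure (h.trans h')) :=
  hX.measurePreserving_of_proj _ fun I =>
    (X.measurePreserving_restrict (I.exists_le_append h h').choose_spec.choose_spec).comp (hX.measurePreserving_glue h h' _ _)

variable (X) in
/-- The inverse of the multiplication on projective limits. -/
noncomputable def flatSplit {r s t : S} (h : r < s) (h' : s < t) (z : X.Flat r t) : X.Flat r s × X.Flat s t :=
  (⟨fun A => (X.split A (.single h') ((X.system r t).proj (A.append (.single h')) z)).1, by
      intro A A' hA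
      beta_reduce
      have hle : A.append (.single h') ≤ A'.append (.single h') :=
        append_le_append.2 ⟨hA, le_rfl⟩
      rw [← (X.system r t).T_proj hle z]
      exact (congrArg Prod.fst (X.restrict_append hA le_rfl hle _)).symm⟩,
    ⟨fun B => (X.split (.single h) B ((X.system r t).proj ((single h).append B) z)).2, by
      intro B B' hB
      beta_reduce
      have hle : (single h).append B ≤ (single h).append B' :=
        append_le_append.2 ⟨le_rfl, hB⟩
      rw [← (X.system r t).T_proj hle z]
      exact (congrArg Prod.snd (X.restrict_append le_rfl hB hle _)).symm⟩)

variable (X) in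
theorem flatSplit_flatMul {r s t : S} (h : r < s) (h' : s < t) :
    LeftInverse (X.flatSplit h h') (X.flatMul h h') := by
  intro p
  refine Prod.ext ?_ ?_
  · exact (X.system r s).thread_ext fun A =>
      congrArg Prod.fst (X.proj_flatMul h h' A (.single h') p)
  · exact (X.system s t).thread_ext fun B =>
      congrArg Prod.snd (X.proj_flatMul h h' (.single h) B p)

variable (X) in
theorem flatMul_flatSplit {r s t : S} (h : r < s) (h' : s < t) :
    RightInverse (X.flatSplit h h') (X.flatMul h h') := by
  intro z
  refine X.flat_ext h h' fun A B => ?_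
  apply (X.split A B).injective
  rw [X.proj_flatMul]
  have h1 : A.append (.single h') ≤ A.append B := append_le_append.2 ⟨le_rfl, single_le h' B⟩
  have h2 : (single h).append B ≤ A.append B := append_le_append.2 ⟨single_le h A, le_rfl⟩
  refine Prod.ext ?_ ?_
  · change (X.split A (.single h') ((X.system r t).proj (A.append (.single h')) z)).1 = _
    rw [← (X.system r t).T_proj h1 z]
    refine (congrArg Prod.fst (X.restrict_append le_rfl (single_le h' B) h1 _)).trans ?_
    exact X.restrict_refl _ _
  · change (X.split (.single h) B ((X.system r t).proj ((single h).append B) z)).2 = _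
    rw [← (X.system r t).T_proj h2 z]
    refine (congrArg Prod.snd (X.restrict_append (single_le h A) le_rfl h2 _)).trans ?_
    exact X.restrict_refl _ _

variable (X) in
theorem measurable_flatSplit {r s t : S} (h : r < s) (h' : s < t) :
    Measurable (X.flatSplit h h') := by
  refine Measurable.prodMk ?_ ?_
  · exact (X.system r s).measurable_thread fun A =>
      measurable_fst.comp ((X.split A _).measurable.comp ((X.system r t).measurable_proj _))
  · exact (X.system s t).measurable_thread fun B =>
      measurable_snd.comp ((X.split _ B).measurable.comp ((X.system r t).measurable_proj _))

theorem Convergent.isProbIso_flatMul {r s t : S} (h : r < s) (h' : s < t) :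
    IsProbIso (X.flatMul h h') ((hX.flatMeasure h).prod (hX.flatMeasure h'))
      (hX.flatMeasure (h.trans h')) := by
  let e : (X.Flat r s × X.Flat s t) ≃ᵐ X.Flat r t :=
    { toFun := X.flatMul h h'
      invFun := X.flatSplit h h'
      left_inv := X.flatSplit_flatMul h h'
      right_inv := X.flatMul_flatSplit h h'
      measurable_toFun := (hX.measurePreserving_flatMul h h').measurable
      measurable_invFun := X.measurable_flatSplit h h' }
  have he : MeasurePreserving e ((hX.flatMeasure h).prod (hX.flatMeasure h'))
      (hX.flatMeasure (h.trans h')) := hX.measurePreserving_flatMul h h'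
  exact ⟨he, _, he.symm e, e.left_inv, e.right_inv⟩

/-- The projective CPPS `X♭` associated with a convergent convolution system `X`. -/
@[reducible]
noncomputable def Convergent.flat : CPPS.{u, max u v} S where
  Ω {s t} _ := X.Flat s t
  μ h := hX.flatMeasure h
  T := X.flatMul
  measurePreserving_T := hX.measurePreserving_flatMul
  assoc := X.flatMul_assoc
  isProbIso_T := hX.isProbIso_flatMul

/-- A morphism of convolution systems. -/
@[ext]
structure Hom (X : ConvolutionSystem.{u, v} S) (Y : ConvolutionSystem.{u, w} S) where
  map : ∀ {s t : S} (h : s < t), X.Ω h → Y.Ω h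
  measurePreserving_map : ∀ {s t : S} (h : s < t), MeasurePreserving (map h) (X.μ h) (Y.μ h)
  map_T : ∀ {r s t : S} (h : r < s) (h' : s < t) (x : X.Ω h) (y : X.Ω h'),
    map (h.trans h') (X.T h h' (x, y)) = Y.T h h' (map h x, map h' y)

namespace Hom

/-- The identity morphism. -/
def id (X : ConvolutionSystem.{u, v} S) : Hom X X where
  map _ x := x
  measurePreserving_map h := MeasurePreserving.id (X.μ h)
  map_T _ _ _ _ := rfl

/-- The composition `η θ` of morphisms. -/
def comp {X : ConvolutionSystem.{u, v} S} {Y : ConvolutionSystem.{u, w} S}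
    {Z : ConvolutionSystem.{u, u'} S} (η : Hom Y Z) (θ : Hom X Y) : Hom X Z where
  map h x := η.map h (θ.map h x)
  measurePreserving_map h := (η.measurePreserving_map h).comp (θ.measurePreserving_map h)
  map_T h h' x y := by rw [θ.map_T, η.map_T]

/-- An isomorphism of convolution systems is a morphism with a two-sided inverse. -/
def IsIso {X : ConvolutionSystem.{u, v} S} {Y : ConvolutionSystem.{u, w} S} (θ : Hom X Y) : Prop :=
  ∃ η : Hom Y X, η.comp θ = Hom.id X ∧ θ.comp η = Hom.id Y

end Hom

/-- The canonical morphism `τ : X♭ → X` consisting of the coordinate projections at the trivial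
partitions `{s, t}`. -/
noncomputable def Convergent.tau : Hom hX.flat.toConvolutionSystem X where
  map {s t} h := (X.system s t).proj (.single h)
  measurePreserving_map h := hX.measurePreserving_proj h (.single h)
  map_T {r s t} h h' x y := by
    refine (X.proj_flatMul_eq h h' (single_le (h.trans h') ((single h).append (single h')))
      (x, y)).trans ?_
    rw [X.restrict_single]
    rfl

end ConvolutionSystem

/-! The passage from a convergent system to its projective CPPS is a functor, and `tau` is a natural
transformation from it to the identity. Functors preserve isomorphisms, so the image of an
isomorphism `θ` is the required `θ♭`, and the required identity is naturality of `tau` at `θ`.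
Invertibility of `θ` enters only through `IsIso.flat`; everything else holds for an arbitrary
morphism.

The action on morphisms comes from the finite levels. Over a partition `I`, `θ` acts on the finite
product `Ω_I` factor by factor. Since `θ` respects each binary multiplication, it respects iterated
multiplications (`comp_spaceMap`), hence the transition maps `T_{I,J}` (`restrict_spaceMap`).
Applying `θ` in every coordinate therefore carries threads to threads.

The induced map preserves the limit measures because a probability measure on the set of threads is
determined by its images at the finite levels, where `θ` acts by a product of measure preserving
maps. It respects the multiplication (`flatMap_flatMul`) because points of the limit over `[r, t]`
are separated by the partitions through `s`, which are cofinal, and over such a partition the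
product splits compatibly with `θ`. Identities and composites are compared coordinate by coordinate,
so all equations hold at every point and not merely almost everywhere. -/

namespace ConvolutionSystem.Hom

open IntervalPartition

variable {S : Type u} [LinearOrder S] {X : ConvolutionSystem.{u, v} S}
  {Y : ConvolutionSystem.{u, w} S} {Z : ConvolutionSystem.{u, u'} S}

/-! ### Morphisms on the finite products over partitions -/

/-- The product of the maps `θ_{ιₖ,ιₖ₊₁}` over a partition. -/
def spaceMap (θ : Hom X Y) {s : S} : {t : S} → (I : IntervalPartition s t) → X.space I → Y.space I
  | _, .single h => θ.map h
  | _, .snoc I h => Prod.map (spaceMap θ I) (θ.map h)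

theorem measurePreserving_spaceMap (θ : Hom X Y) {s t : S} (I : IntervalPartition s t) :
    MeasurePreserving (θ.spaceMap I) (X.measure I) (Y.measure I) := by
  induction I with
  | single h => exact θ.measurePreserving_map h
  | snoc I h ih => exact ih.prod (θ.measurePreserving_map h)

theorem spaceMap_id {s t : S} (I : IntervalPartition s t) (x : X.space I) :
    (Hom.id X).spaceMap I x = x := by
  induction I with
  | single h => rfl
  | snoc I h ih => exact Prod.ext (ih x.1) rfl

theorem spaceMap_comp (η : Hom Y Z) (θ : Hom X Y) {s t : S} (I : IntervalPartition s t)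
    (x : X.space I) : (η.comp θ).spaceMap I x = η.spaceMap I (θ.spaceMap I x) := by
  induction I with
  | single h => rfl
  | snoc I h ih => exact Prod.ext (ih x.1) rfl

/-- `split` only moves brackets, and a product of maps is insensitive to bracketing. An induction is
still needed because `split` and `spaceMap` both recurse on `J`, so the two sides do not unfold for
a variable `J`. -/
theorem split_spaceMap (θ : Hom X Y) {r s t : S} (I : IntervalPartition r s)
    (J : IntervalPartition s t) (x : X.space (I.append J)) :
    Y.split I J (θ.spaceMap (I.append J) x) =
      (θ.spaceMap I (X.split I J x).1, θ.spaceMap J (X.split I J x).2) := by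
  induction J with
  | single h => rfl
  | snoc J h ih =>
    have e := Prod.ext_iff.1 (ih x.1)
    exact Prod.ext e.1 (Prod.ext e.2 rfl)

/-- Compatibility of `θ` with the binary multiplication is used once for each point adjoined to the
partition. This is the case of a trivial coarse partition in `restrict_spaceMap`. -/
theorem comp_spaceMap (θ : Hom X Y) {s t : S} (J : IntervalPartition s t) (x : X.space J) :
    Y.comp J (θ.spaceMap J x) = θ.map J.lt (X.comp J x) := by
  induction J with
  | single h => rfl
  | snoc J h ih =>
    -- `map_T` moves `θ` inside the outermost multiplication; the last factors then agree, and the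
    -- first ones agree by induction.
    refine Eq.trans ?_ (θ.map_T J.lt h (X.comp J x.1) x.2).symm
    exact congrArg (fun y => Y.T J.lt h (y, θ.map h x.2)) (ih x.1)

/-- Naturality of the transition maps, which makes the induced map on threads well defined. Each
block of the decomposition of `J` along `I` is multiplied out separately, so `comp_spaceMap` can be
applied block by block. -/
theorem restrict_spaceMap (θ : Hom X Y) {s t : S} {I J : IntervalPartition s t} (h : I ≤ J)
    (x : X.space J) : Y.restrict h (θ.spaceMap J x) = θ.spaceMap I (X.restrict h x) := by
  -- A decomposition `R` involves only the partitions and not the spaces, so the same `R` computes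
  -- the transition maps of both `X` and `Y`.
  obtain ⟨R⟩ := nonempty_refinement h
  rw [X.restrict_eq h R, Y.restrict_eq h R]
  -- The goal now depends on `R` alone; keeping `h` would add an order hypothesis to the induction
  -- hypothesis.
  clear h
  induction R with
  | single h J => exact θ.comp_spaceMap J x
  | @snoc j t I J R h K ih =>
    -- After splitting off the last block `K`, the earlier blocks are covered by induction and `K`
    -- by `comp_spaceMap`.
    have e := Prod.ext_iff.1 (θ.split_spaceMap J K x)
    exact Prod.ext ((congrArg (Y.restrictAux R) e.1).trans (ih _))
      ((congrArg (Y.comp K) e.2).trans (θ.comp_spaceMap K _))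

/-! ### Functoriality of the projective limit -/

/-- The map induced by a morphism on projective limits. -/
noncomputable def flatMap (θ : Hom X Y) {s t : S} (z : X.Flat s t) : Y.Flat s t :=
  ⟨fun I => θ.spaceMap I ((X.system s t).proj I z), fun I _ h =>
    (θ.restrict_spaceMap h _).trans (congrArg (θ.spaceMap I) ((X.system s t).T_proj h z))⟩

theorem flatMap_flatMul (θ : Hom X Y) {r s t : S} (h : r < s) (h' : s < t) (x : X.Flat r s)
    (y : X.Flat s t) :
    θ.flatMap (X.flatMul h h' (x, y)) = Y.flatMul h h' (θ.flatMap x, θ.flatMap y) := by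
  -- It suffices to compare coordinates at partitions through `s`, where multiplication in the limit
  -- is mere juxtaposition of coordinates.
  refine Y.flat_ext h h' fun A B => (Y.split A B).injective ?_
  rw [Y.proj_flatMul]
  refine (θ.split_spaceMap A B _).trans ?_
  rw [X.proj_flatMul]
  rfl

/-- The morphism `X♭ → Y♭` induced by a morphism `X → Y` of convergent convolution systems. -/
noncomputable def flat (θ : Hom X Y) (hX : X.Convergent) (hY : Y.Convergent) :
    Hom hX.flat.toConvolutionSystem hY.flat.toConvolutionSystem where
  map _ := θ.flatMap
  -- Only the finite levels need checking: the coordinate at `I` is the projection of `X♭` followed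
  -- by the product map.
  measurePreserving_map h := hY.measurePreserving_of_proj h fun I =>
    (θ.measurePreserving_spaceMap I).comp (hX.measurePreserving_proj h I)
  map_T := θ.flatMap_flatMul

theorem flat_id (hX : X.Convergent) :
    (Hom.id X).flat hX hX = Hom.id hX.flat.toConvolutionSystem := by
  ext s t h z
  exact (X.system s t).thread_ext fun I => spaceMap_id I _

theorem flat_comp (η : Hom Y Z) (θ : Hom X Y) (hX : X.Convergent) (hY : Y.Convergent)
    (hZ : Z.Convergent) : (η.comp θ).flat hX hZ = (η.flat hY hZ).comp (θ.flat hX hY) := by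
  ext s t h z
  exact (Z.system s t).thread_ext fun I => spaceMap_comp η θ I _

/-- Definitional: over the trivial partition the product of maps has the single factor `θ.map h`, so
the coordinate of the induced map there is `θ` applied to the coordinate of the thread. -/
theorem comp_tau (θ : Hom X Y) (hX : X.Convergent) (hY : Y.Convergent) :
    θ.comp hX.tau = hY.tau.comp (θ.flat hX hY) :=
  rfl

/-- The inverse is induced by the inverse of `θ`; functoriality turns the two inverse identities for
`θ` into those for the induced morphism. -/
theorem IsIso.flat {θ : Hom X Y} (hθ : θ.IsIso) (hX : X.Convergent) (hY : Y.Convergent) :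
    (θ.flat hX hY).IsIso := by
  obtain ⟨η, h, h'⟩ := hθ
  exact ⟨η.flat hY hX, by rw [← flat_comp, h, flat_id], by rw [← flat_comp, h', flat_id]⟩

end ConvolutionSystem.Hom

theorem corollary3p4 {S : Type u} [LinearOrder S]
    (S₁ : ConvolutionSystem.{u, v} S) (S₂ : ConvolutionSystem.{u, w} S)
    (h₁ : S₁.Convergent) (h₂ : S₂.Convergent)
    (θ : ConvolutionSystem.Hom S₁ S₂) (hθ : θ.IsIso) :
    ∃ θb : ConvolutionSystem.Hom h₁.flat.toConvolutionSystem h₂.flat.toConvolutionSystem,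
      θb.IsIso ∧ θ.comp h₁.tau = h₂.tau.comp θb :=
  ⟨θ.flat h₁ h₂, hθ.flat h₁ h₂, θ.comp_tau h₁ h₂⟩
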